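/- Let $D$ be an oriented link diagram with ordered crossings, $n$ of them negative, and writhe $w$. A state $s$ labels each crossing $A$ or $B$. An enhanced state also assigns a sign $\pm1$ to each circle of the smoothed diagram $sD$ (where an $A$-label opens the regions swept by turning the over strand counterclockwise). Put $i(s)=\frac{w-\sigma}{2}$ and $j(s)=w+i(s)+\tau$, where $\sigma$ is the number of $A$-labels minus the number of $B$-labels and $\tau$ is the sum of the signs. For a commutative ring $R$ with unit, let $C^{i,j}(D)$ be the free $R$-module on the enhanced states with $i(s)=i$ and $j(s)=j$. The differential is $d_i(s)=\sum_t (s:t)\,t$, where $t$ runs over the enhanced states with $i(t)=i(s)+1$ and $j(t)=j(s)$ whose labels agree with those of $s$ except at one crossing $x$, changed from $A$ to $B$, and whose signs agree with those of $s$ on all circles not touching $x$. Here $(s:t)=(-1)^k$ with $k$ the number of $B$-labelled crossings after $x$. Let $H^{i,j}(D)=\ker d_i/\operatorname{im} d_{i-1}$ be the Khovanov cohomology over $R$, and let $j_{\min}(D)$ be the minimum of $j(s)$ over all enhanced states of $D$. Let $s_A$ be the state with all labels $A$. The Lando graph of $D$ has as vertices the crossings whose chord in $s_AD$ has both ends on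 the same circle, and two of them are adjacent if the ends of their chords alternate on the same circle. **Theorem.** There is an oriented link diagram $D$ with $11$ crossings, exactly $3$ of them negative, such that $s_AD$ consists of a single circle, the Lando graph of $D$ consists of two hexagons sharing exactly one vertex, $j_{\min}(D)=1$, and for every commutative ring $R$ with unit $$H^{0,1}(D)\cong H^{1,1}(D)\cong R,\qquad H^{i,1}(D)=0\ \text{ for } i\neq 0,1 .$$ In particular (for instance over $R=\mathbb Z$) the extreme Khovanov cohomology $H^{i,j_{\min}}(D)$ is non-trivial for two different values of $i$. -/

import Mathlib

/-!
Oriented link diagrams are encoded by planar diagram codes.  At every crossing there are four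
strand ends, numbered counterclockwise by `0, 1, 2, 3`, where `0` is the incoming end of the under
strand.  So `2` is the outgoing end of the under strand and `1`, `3` are the ends of the over
strand.  If the crossing is positive the over strand runs from `3` to `1`, otherwise
from `1` to `3`.
-/

/-- Whether the strand end at position `k` of a crossing of the given sign points
into the crossing. -/
def isIncoming (positive : Bool) (k : Fin 4) : Bool :=
  if k = 0 then true
  else if k = 1 then !positive
  else if k = 2 then false
  else positive

/-- Finitely many signed crossings (numbered `0, 1, …`), together with the pairing of
the strand ends `(x, k)` given by the arcs of the diagram: the arc that starts at the end `d` stops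
at the end `glue d`.  Arcs run from an outgoing end to an incoming end.  Planarity is not
yet imposed. -/
structure OrientedDiagramCode where
  crossings : ℕ
  positive : Fin crossings → Bool
  glue : Fin crossings × Fin 4 → Fin crossings × Fin 4
  glue_involutive : Function.Involutive glue
  glue_oriented : ∀ d : Fin crossings × Fin 4,
    isIncoming (positive (glue d).1) (glue d).2 = !isIncoming (positive d.1) d.2

namespace OrientedDiagramCode

/-- The strand ends. -/
abbrev End (D : OrientedDiagramCode) : Type := Fin D.crossings × Fin 4

/-- The connected components of the underlying four-valent graph. -/
def Piece (D : OrientedDiagramCode) : Type :=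
  Quot (fun d d' : D.End => d' = D.glue d ∨ d' = (d.1, d.2 + 1))

/-- The faces of the surface in which the four-valent graph is embedded cellularly with the given
cyclic orders at its vertices.  An end `d = (x, k)` stands for the corner at `x` between
the positions `k` and `k + 1`; walking along the arc that leaves `x` at `(x, k)`, this corner is on
the left, and it is followed by the corner just clockwise of the end `glue d`. -/
def Face (D : OrientedDiagramCode) : Type :=
  Quot (fun d d' : D.End => d' = ((D.glue d).1, (D.glue d).2 - 1))

end OrientedDiagramCode

/-- Oriented link diagrams in the sphere (equivalently, in the plane) in which each link component
passes through at least one crossing.  Planarity is Euler's formula `V - E + F = 2 K` with `V`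
crossings, `E = 2 V` arcs, `F` faces and `K` connected pieces (each piece has genus zero).  For a
diagram with several pieces the relative position of the pieces is not recorded: no
notion used here depends on it. -/
structure OrientedLinkDiagram extends OrientedDiagramCode where
  planar : Nat.card toOrientedDiagramCode.Face =
    crossings + 2 * Nat.card toOrientedDiagramCode.Piece

/-- The cohomology `ker g / im f` at the middle term of `M → N → P`. -/
abbrev CohomologyAt {R M N P : Type*} [CommRing R] [AddCommGroup M] [Module R M]
    [AddCommGroup N] [Module R N] [AddCommGroup P] [Module R P]
    (f : M →ₗ[R] N) (g : N →ₗ[R] P) : Type _ :=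
  LinearMap.ker g ⧸ (LinearMap.range f).submoduleOf (LinearMap.ker g)

namespace OrientedLinkDiagram

/-- The strand ends of the diagram. -/
abbrev End (D : OrientedLinkDiagram) : Type := Fin D.crossings × Fin 4

/-- The number of positive crossings. -/
def numPos (D : OrientedLinkDiagram) : ℕ :=
  (Finset.univ.filter fun x => D.positive x = true).card

/-- The number of negative crossings. -/
def numNeg (D : OrientedLinkDiagram) : ℕ :=
  (Finset.univ.filter fun x => D.positive x = false).card

/-- The writhe. -/
def writhe (D : OrientedLinkDiagram) : ℤ := (D.numPos : ℤ) - (D.numNeg : ℤ)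

/-- A state labels each crossing by `A` (encoded by `false`) or `B` (encoded by `true`). -/
abbrev State (D : OrientedLinkDiagram) : Type := Fin D.crossings → Bool

/-- The state with an `A`-label at each crossing. -/
def stateA (D : OrientedLinkDiagram) : D.State := fun _ => false

/-- The number of `A`-labels. -/
def numA (D : OrientedLinkDiagram) (s : D.State) : ℕ :=
  (Finset.univ.filter fun x => s x = false).card

/-- The number of `B`-labels. -/
def numB (D : OrientedLinkDiagram) (s : D.State) : ℕ :=
  (Finset.univ.filter fun x => s x = true).card

/-- The position that is joined to position `k` by a smoothing.  Turning the over strand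
counterclockwise sweeps the regions between `1` and `2` and between `3` and `0`.  The `A`-smoothing
opens these regions to each other, so it joins `0` to `1` and `2` to `3`; the `B`-smoothing
joins `0` to `3` and `1` to `2`. -/
def smooth (label : Bool) (k : Fin 4) : Fin 4 :=
  if label then ![3, 2, 1, 0] k else ![1, 0, 3, 2] k

/-- The circles of the smoothed diagram `sD`: two strand ends lie on the same circle when
they are connected by arcs of the diagram and by smoothing arcs. -/
def Circle (D : OrientedLinkDiagram) (s : D.State) : Type :=
  Quot (fun d d' : D.End => d' = D.glue d ∨ d' = (d.1, smooth (s d.1) d.2))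

/-- The circle through a strand end. -/
def circle (D : OrientedLinkDiagram) (s : D.State) (d : D.End) : D.Circle s := Quot.mk _ d

instance (D : OrientedLinkDiagram) (s : D.State) : Finite (D.Circle s) :=
  inferInstanceAs (Finite (Quot _))

noncomputable instance (D : OrientedLinkDiagram) (s : D.State) : Fintype (D.Circle s) :=
  Fintype.ofFinite _

/-! ### Khovanov cohomology through enhanced states -/

/-- An enhanced state: a state `s` and a sign for each circle of `sD`. -/
abbrev EnhancedState (D : OrientedLinkDiagram) : Type :=
  (s : D.State) × (D.Circle s → ℤˣ)

/-- `σ(s) = a(s) - b(s)`. -/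
def sigma (D : OrientedLinkDiagram) (s : D.State) : ℤ := (D.numA s : ℤ) - (D.numB s : ℤ)

/-- `τ(S)`: the sum of the signs of the circles. -/
noncomputable def tau (D : OrientedLinkDiagram) (S : D.EnhancedState) : ℤ :=
  ∑ k : D.Circle S.1, ((S.2 k : ℤˣ) : ℤ)

/-- The degree `i(S) = (w - σ) / 2`; the division is exact, see `two_mul_degI`. -/
def degI (D : OrientedLinkDiagram) (S : D.EnhancedState) : ℤ := (D.writhe - D.sigma S.1) / 2

/-- The degree `j(S) = w + i(S) + τ(S)`. -/
noncomputable def degJ (D : OrientedLinkDiagram) (S : D.EnhancedState) : ℤ :=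
  D.writhe + D.degI S + D.tau S

theorem degI_eq (D : OrientedLinkDiagram) (S : D.EnhancedState) :
    D.degI S = (D.numB S.1 : ℤ) - (D.numNeg : ℤ) := by
  have h1 := Finset.card_filter_add_card_filter_not
    (s := (Finset.univ : Finset (Fin D.crossings))) (fun x => D.positive x = true)
  have h2 := Finset.card_filter_add_card_filter_not
    (s := (Finset.univ : Finset (Fin D.crossings))) (fun x => S.1 x = true)
  simp only [Bool.not_eq_true] at h1 h2
  unfold degI writhe sigma numPos numNeg numA numB
  omega

theorem two_mul_degI (D : OrientedLinkDiagram) (S : D.EnhancedState) :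
    2 * D.degI S = D.writhe - D.sigma S.1 := by
  have h1 := Finset.card_filter_add_card_filter_not
    (s := (Finset.univ : Finset (Fin D.crossings))) (fun x => D.positive x = true)
  have h2 := Finset.card_filter_add_card_filter_not
    (s := (Finset.univ : Finset (Fin D.crossings))) (fun x => S.1 x = true)
  simp only [Bool.not_eq_true] at h1 h2
  unfold degI writhe sigma numPos numNeg numA numB
  omega

/-- `T` is adjacent to `S` with change crossing `x`.  The circles common to `sD` and `tD` are those
that do not touch `x`. -/
def AdjacentAt (D : OrientedLinkDiagram) (S T : D.EnhancedState) (x : Fin D.crossings) : Prop :=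
  D.degI T = D.degI S + 1 ∧ D.degJ T = D.degJ S ∧
  S.1 x = false ∧ T.1 x = true ∧ (∀ y, y ≠ x → T.1 y = S.1 y) ∧
  ∀ d : D.End, (∀ k : Fin 4, D.circle S.1 d ≠ D.circle S.1 (x, k)) →
    T.2 (D.circle T.1 d) = S.2 (D.circle S.1 d)

open Classical in
/-- The incidence number `(S : T)`: it is `(-1) ^ k` if `T` is adjacent to `S`, where `k` is the
number of `B`-labelled crossings after the change crossing, and `0` otherwise.  (At most one
summand is not zero, as the change crossing is unique.) -/
noncomputable def incidence (D : OrientedLinkDiagram) (S T : D.EnhancedState) : ℤ :=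
  ∑ x : Fin D.crossings,
    if D.AdjacentAt S T x then
      (-1) ^ (Finset.univ.filter fun y => x < y ∧ S.1 y = true).card
    else 0

/-- The enhanced states of bidegree `(i, j)`. -/
abbrev Generator (D : OrientedLinkDiagram) (i j : ℤ) : Type :=
  {S : D.EnhancedState // D.degI S = i ∧ D.degJ S = j}

/-- The cochain module `C^{i,j}(D)`: the free `R`-module on the enhanced states of
bidegree `(i, j)`. -/
abbrev Chain (R : Type*) [CommRing R] (D : OrientedLinkDiagram) (i j : ℤ) : Type _ :=
  D.Generator i j →₀ R

/-- The linear map `C^{i,j}(D) → C^{i',j}(D)` sending `S` to the sum of all `(S : T) T`.  It is the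
Khovanov differential for `i' = i + 1` (and zero otherwise). -/
noncomputable def differential (R : Type*) [CommRing R] (D : OrientedLinkDiagram) (i i' j : ℤ) :
    D.Chain R i j →ₗ[R] D.Chain R i' j :=
  Finsupp.linearCombination R fun S : D.Generator i j =>
    Finsupp.equivFunOnFinite.symm fun T : D.Generator i' j => ((D.incidence S.1 T.1 : ℤ) : R)

/-- The Khovanov cohomology module `H^{i,j}(D) = ker d_i / im d_{i-1}` over `R`. -/
abbrev Khovanov (R : Type*) [CommRing R] (D : OrientedLinkDiagram) (i j : ℤ) : Type _ :=
  CohomologyAt (D.differential R (i - 1) i j) (D.differential R i (i + 1) j)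

/-! ### The Lando graph -/

/-- The `A`-chord at `x` joins, in `s_A D`, the smoothing arc through the ends `0, 1` to the one
through the ends `2, 3`.  It is admissible if both lie on the same circle. -/
def Admissible (D : OrientedLinkDiagram) (x : Fin D.crossings) : Prop :=
  D.circle D.stateA (x, 0) = D.circle D.stateA (x, 2)

/-- The circles of `s_A D`, cut open at the two ends of the `A`-chord at `x`. -/
def CutCircle (D : OrientedLinkDiagram) (x : Fin D.crossings) : Type :=
  Quot (fun d d' : D.End => d' = D.glue d ∨ (d.1 ≠ x ∧ d' = (d.1, smooth false d.2)))

/-- The two ends of the `A`-chord at `y` are separated when the circles of `s_A D` are cut at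
the two ends of the `A`-chord at `x`.  For different admissible chords this says that their
ends alternate in the same circle; it is then symmetric in `x` and `y`. -/
def Alternate (D : OrientedLinkDiagram) (x y : Fin D.crossings) : Prop :=
  (Quot.mk _ (y, 0) : D.CutCircle x) ≠ Quot.mk _ (y, 2)

/-- The Lando graph: the vertices are the admissible `A`-chords of `s_A D`, and two of them are
adjacent if their ends alternate in the same circle. -/
def landoGraph (D : OrientedLinkDiagram) : SimpleGraph {x : Fin D.crossings // D.Admissible x} :=
  SimpleGraph.fromRel fun x y => D.Alternate x.1 y.1

end OrientedLinkDiagram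

/-- Two hexagons `0 1 2 3 4 5` and `0 6 7 8 9 10` that share exactly the vertex `0`. -/
def twoHexagons : SimpleGraph (Fin 11) :=
  SimpleGraph.fromEdgeSet
    {s(0, 1), s(1, 2), s(2, 3), s(3, 4), s(4, 5), s(5, 0),
     s(0, 6), s(6, 7), s(7, 8), s(8, 9), s(9, 10), s(10, 0)}

/-! Suppose that `s_A D` is a single circle. A `ZMod 2`-valued function on the circles of `sD` is
then determined by one value and by one jump at each `B`-labelled crossing, so `sD` has at most
`numB s + 1` circles. Equality holds exactly when the chords of the `B`-labelled crossings do not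
alternate pairwise (`IsSideSystem.card_circle_eq_iff`): in that case the functions `side x` realise
all jumps.

Since `j = w - n + numB + τ` and `τ` is at least minus the number of circles, `j ≥ w - n - 1`, with
equality exactly for noncrossing states with all signs `-1`. The extreme complex is therefore the
augmented cochain complex of the independence complex of the Lando graph, a set of `k` crossings
having degree `i = k - n` (`IsSideSystem.differential_restrict`).

For two hexagons sharing a vertex, a matching tree pairs off all independent sets except `{0, 3, 8}`
and `{2, 5, 7, 10}` (`isToggling`, `eq_of_six_le_block`). Both are maximal, so cochains supported on
them are cocycles, and each contributes one copy of `R` (`IsSideSystem.nonempty_khovanov_equiv`).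
Their sizes 3 and 4 give `i = 0` and `i = 1`, as `n = 3`. Planarity, the chord pattern and the signs
of the explicit diagram are finite checks. -/

/-! ### Counting the circles of a state by linear algebra over `ZMod 2`. -/

namespace OrientedLinkDiagram

/-- `side x` tells the two arcs apart into which the single circle of `s_A D` is cut by the
`A`-chord at `x`, and the ends of the chord are such that the `B`-smoothing at `x` closes up each
of these two arcs. -/
structure IsSideSystem (D : OrientedLinkDiagram) (side : Fin D.crossings → D.End → ZMod 2) :
    Prop where
  glue : ∀ x d, side x (D.glue d) = side x d
  smooth_of_ne : ∀ x y k, y ≠ x → side x (y, smooth false k) = side x (y, k)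
  smooth_self : ∀ x k, side x (x, smooth true k) = side x (x, k)
  jump : ∀ x, side x (x, 0) + side x (x, 1) = 1

variable {D : OrientedLinkDiagram} {side : Fin D.crossings → D.End → ZMod 2}

theorem circle_glue (s : D.State) (d : D.End) : D.circle s (D.glue d) = D.circle s d :=
  Eq.symm (Quot.sound (r := fun d d' => d' = D.glue d ∨ d' = (d.1, smooth (s d.1) d.2))
    (Or.inl rfl))

theorem circle_smooth (s : D.State) (x : Fin D.crossings) (k : Fin 4) :
    D.circle s (x, smooth (s x) k) = D.circle s (x, k) :=
  Eq.symm (Quot.sound (r := fun d d' => d' = D.glue d ∨ d' = (d.1, smooth (s d.1) d.2))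
    (a := (x, k)) (Or.inr rfl))

theorem circle_zero_three {s : D.State} {x : Fin D.crossings} (h : s x = true) :
    D.circle s (x, 0) = D.circle s (x, 3) := by
  have := circle_smooth s x 3
  rw [h] at this
  exact this

theorem circle_one_two {s : D.State} {x : Fin D.crossings} (h : s x = true) :
    D.circle s (x, 1) = D.circle s (x, 2) := by
  have := circle_smooth s x 2
  rw [h] at this
  exact this

/-- If `s_A D` is connected, a function on the strand ends that is constant along the arcs of the
diagram is determined by one value and by its jumps at the `A`-smoothing arcs. -/
theorem eq_of_jumps (hA : Subsingleton (D.Circle D.stateA)) {f g : D.End → ZMod 2} (d₀ : D.End)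
    (hf : ∀ d, f (D.glue d) = f d) (hg : ∀ d, g (D.glue d) = g d) (h₀ : f d₀ = g d₀)
    (hj : ∀ y, f (y, 0) + f (y, 1) = g (y, 0) + g (y, 1) ∧
      f (y, 2) + f (y, 3) = g (y, 2) + g (y, 3)) : f = g := by
  have hs : ∀ d d' : D.End, d' = D.glue d ∨ d' = (d.1, smooth (D.stateA d.1) d.2) →
      f d - g d = f d' - g d' := by
    rintro ⟨y, k⟩ d' (rfl | rfl)
    · rw [hf, hg]
    · obtain ⟨h1, h2⟩ := hj y
      have c : ∀ a b a' b' : ZMod 2, a + b = a' + b' → a - a' = b - b' := by decide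
      have h1' := c _ _ _ _ h1
      have h2' := c _ _ _ _ h2
      fin_cases k
      · exact h1'
      · exact h1'.symm
      · exact h2'
      · exact h2'.symm
  funext d
  have : D.circle D.stateA d = D.circle D.stateA d₀ := Subsingleton.elim _ _
  have := congrArg (Quot.lift (fun d => f d - g d) hs) this
  change f d - g d = f d₀ - g d₀ at this
  rw [h₀, sub_self] at this
  exact sub_eq_zero.1 this

/-- The value of a function on the circles of `sD` at a base point, and its jumps at the
`A`-smoothing arcs of the `B`-labelled crossings. -/
def jumps (s : D.State) (d₀ : D.End) :
    (D.Circle s → ZMod 2) →ₗ[ZMod 2] ZMod 2 × ({x // s x = true} → ZMod 2) where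
  toFun g := (g (D.circle s d₀), fun x => g (D.circle s (x.1, 0)) + g (D.circle s (x.1, 1)))
  map_add' f g := by
    ext
    · rfl
    · simp only [Pi.add_apply, Prod.snd_add]
      ring
  map_smul' c g := by
    ext
    · rfl
    · simp only [Pi.smul_apply, smul_eq_mul, Prod.smul_snd, RingHom.id_apply]
      ring

theorem add_smooth_eq_zero (s : D.State) (g : D.Circle s → ZMod 2) {y : Fin D.crossings}
    (hy : s y = false) :
    g (D.circle s (y, 0)) + g (D.circle s (y, 1)) = 0 ∧
      g (D.circle s (y, 2)) + g (D.circle s (y, 3)) = 0 := by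
  have h1 : D.circle s (y, 1) = D.circle s (y, 0) := by
    have := circle_smooth s y 0
    rw [hy] at this
    exact this
  have h2 : D.circle s (y, 3) = D.circle s (y, 2) := by
    have := circle_smooth s y 2
    rw [hy] at this
    exact this
  rw [h1, h2]
  exact ⟨CharTwo.add_self_eq_zero _, CharTwo.add_self_eq_zero _⟩

/-- The `B`-smoothing joins `0` to `3` and `1` to `2`, so the jump between `2` and `3` repeats the
one between `0` and `1`; at `A`-labels there is no jump. The recorded data thus fix all jumps in
`eq_of_jumps`. -/
theorem jumps_injective (hA : Subsingleton (D.Circle D.stateA)) (s : D.State) (d₀ : D.End) :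
    Function.Injective (jumps s d₀) := by
  refine (injective_iff_map_eq_zero _).2 fun g hg => ?_
  have h1 : g (D.circle s d₀) = 0 := congrArg Prod.fst hg
  have h2 : ∀ x, s x = true → g (D.circle s (x, 0)) + g (D.circle s (x, 1)) = 0 :=
    fun x hx => congrFun (congrArg Prod.snd hg) ⟨x, hx⟩
  have key : (fun d => g (D.circle s d)) = fun _ => 0 := by
    refine eq_of_jumps hA d₀ (fun d => by rw [circle_glue]) (fun _ => rfl) h1 fun y => ?_
    rw [add_zero]
    cases hy : s y
    · exact add_smooth_eq_zero s g hy
    · refine ⟨h2 y hy, ?_⟩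
      rw [← circle_zero_three hy, ← circle_one_two hy, add_comm]
      exact h2 y hy
  funext k
  induction k using Quot.ind with
  | mk d => exact congrFun key d

theorem finrank_jumps (s : D.State) :
    Module.finrank (ZMod 2) (ZMod 2 × ({x // s x = true} → ZMod 2)) = D.numB s + 1 := by
  rw [Module.finrank_prod, Module.finrank_self, Module.finrank_fintype_fun_eq_card,
    Fintype.card_subtype, numB, add_comm]

theorem card_circle_le (hA : Subsingleton (D.Circle D.stateA)) (d₀ : D.End) (s : D.State) :
    Fintype.card (D.Circle s) ≤ D.numB s + 1 := by
  have := LinearMap.finrank_le_finrank_of_injective (jumps_injective hA s d₀)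
  rwa [finrank_jumps, Module.finrank_fintype_fun_eq_card] at this

theorem card_circle_eq_iff_surjective (hA : Subsingleton (D.Circle D.stateA)) (d₀ : D.End)
    (s : D.State) :
    Fintype.card (D.Circle s) = D.numB s + 1 ↔ Function.Surjective (jumps s d₀) := by
  rw [← finrank_jumps, ← Module.finrank_fintype_fun_eq_card (ZMod 2)]
  refine ⟨fun h => (LinearMap.injective_iff_surjective_of_finrank_eq_finrank h).1
    (jumps_injective hA s d₀), fun h => ?_⟩
  exact (LinearEquiv.ofBijective _ ⟨jumps_injective hA s d₀, h⟩).finrank_eq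

/-- No two chords of the `B`-labelled crossings alternate. -/
def Noncrossing (side : Fin D.crossings → D.End → ZMod 2) (s : D.State) : Prop :=
  ∀ x y, s x = true → s y = true → x ≠ y → side x (y, 0) = side x (y, 2)

namespace IsSideSystem

theorem zero_one (H : D.IsSideSystem side) {x y : Fin D.crossings} (h : y ≠ x) :
    side x (y, 1) = side x (y, 0) := H.smooth_of_ne x y 0 h

theorem two_three (H : D.IsSideSystem side) {x y : Fin D.crossings} (h : y ≠ x) :
    side x (y, 3) = side x (y, 2) := H.smooth_of_ne x y 2 h

/-- For noncrossing `s`, `side x` descends to the circles of `sD`: at another `B`-labelled crossing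
all four ends lie on the same side of the chord at `x`. -/
theorem invariant (H : D.IsSideSystem side) {s : D.State} (hs : Noncrossing side s)
    {x : Fin D.crossings} (hx : s x = true) (d d' : D.End)
    (h : d' = D.glue d ∨ d' = (d.1, smooth (s d.1) d.2)) : side x d = side x d' := by
  obtain ⟨y, k⟩ := d
  rcases h with rfl | rfl
  · exact (H.glue x _).symm
  · by_cases hyx : y = x
    · subst hyx
      simp only [hx]
      exact (H.smooth_self y k).symm
    · cases hy : s y
      · dsimp only
        exact (H.smooth_of_ne x y k hyx).symm
      · dsimp only
        have h1 := hs x y hx hy (Ne.symm hyx)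
        have h2 := H.zero_one hyx
        have h3 := H.two_three hyx
        fin_cases k
        · exact h1.trans h3.symm
        · exact h2.trans h1
        · exact h1.symm.trans h2.symm
        · exact h3.trans h1.symm

theorem jumps_surjective (H : D.IsSideSystem side) {s : D.State} (hs : Noncrossing side s)
    (d₀ : D.End) : Function.Surjective (jumps s d₀) := by
  rintro ⟨a, b⟩
  -- Each `side x` jumps only at `x`, so this combination has prescribed jumps `b`; subtracting the
  -- base values makes its value at `d₀` equal to `a`.
  let f : D.End → ZMod 2 := fun d => a + ∑ x : {x // s x = true}, b x * (side x.1 d - side x.1 d₀)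
  have hf : ∀ d d' : D.End, d' = D.glue d ∨ d' = (d.1, smooth (s d.1) d.2) → f d = f d' := by
    intro d d' h
    refine congrArg (a + ·) (Finset.sum_congr rfl fun x _ => ?_)
    rw [H.invariant hs x.2 d d' h]
  refine ⟨Quot.lift f hf, Prod.ext ?_ (funext fun y => ?_)⟩
  · change f d₀ = a
    simp [f]
  · change f (y.1, 0) + f (y.1, 1) = b y
    have h2 : (2 : ZMod 2) = 0 := by decide
    have : ∀ x : {x // s x = true}, x ≠ y →
        b x * (side x.1 (y.1, 0) - side x.1 d₀) + b x * (side x.1 (y.1, 1) - side x.1 d₀) = 0 := by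
      intro x hxy
      rw [H.zero_one fun h => hxy (Subtype.ext h.symm)]
      exact CharTwo.add_self_eq_zero _
    calc f (y.1, 0) + f (y.1, 1)
        = 2 * a + ∑ x : {x // s x = true}, (b x * (side x.1 (y.1, 0) - side x.1 d₀) +
            b x * (side x.1 (y.1, 1) - side x.1 d₀)) := by
          rw [Finset.sum_add_distrib]
          simp only [f]
          ring
      _ = b y * (side y.1 (y.1, 0) - side y.1 d₀) + b y * (side y.1 (y.1, 1) - side y.1 d₀) := by
          rw [h2, zero_mul, zero_add]
          exact Finset.sum_eq_single y (fun x _ h => this x h) (by simp)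
      _ = b y * (side y.1 (y.1, 0) + side y.1 (y.1, 1)) - 2 * (b y * side y.1 d₀) := by ring
      _ = b y := by rw [H.jump, h2]; ring

theorem noncrossing_of_surjective (H : D.IsSideSystem side)
    (hA : Subsingleton (D.Circle D.stateA)) {s : D.State} {d₀ : D.End}
    (hs : Function.Surjective (jumps s d₀)) : Noncrossing side s := by
  intro x y hx hy hxy
  -- A preimage of the data of `side x` has to be `side x` itself, which is therefore constant on
  -- circles of `sD`; the `B`-smoothing at `y` then forbids `x` and `y` to alternate.
  obtain ⟨g, hg⟩ := hs (side x d₀, Pi.single ⟨x, hx⟩ 1)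
  have h1 : g (D.circle s d₀) = side x d₀ := congrArg Prod.fst hg
  have h2 : ∀ z (hz : s z = true), g (D.circle s (z, 0)) + g (D.circle s (z, 1)) =
      (Pi.single ⟨x, hx⟩ 1 : {x // s x = true} → ZMod 2) ⟨z, hz⟩ :=
    fun z hz => congrFun (congrArg Prod.snd hg) ⟨z, hz⟩
  have h3 : ∀ z, z ≠ x → side x (z, 0) + side x (z, 1) = 0 ∧
      side x (z, 2) + side x (z, 3) = 0 := fun z hz => by
    rw [H.zero_one hz, H.two_three hz]
    exact ⟨CharTwo.add_self_eq_zero _, CharTwo.add_self_eq_zero _⟩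
  have key : (fun d => g (D.circle s d)) = side x := by
    refine eq_of_jumps hA d₀ (fun d => by rw [circle_glue]) (H.glue x) h1 fun z => ?_
    by_cases hzx : z = x
    · subst hzx
      have h4 := h2 z hx
      rw [Pi.single_eq_same] at h4
      have h5 : side z (z, 2) + side z (z, 3) = 1 := by
        rw [← H.jump z, add_comm]
        exact congrArg₂ (· + ·) (H.smooth_self z 3).symm (H.smooth_self z 2).symm
      refine ⟨h4.trans (H.jump z).symm, ?_⟩
      rw [h5, ← circle_zero_three hx, ← circle_one_two hx, add_comm]
      exact h4
    · rw [(h3 z hzx).1, (h3 z hzx).2]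
      cases hz : s z
      · exact add_smooth_eq_zero s g hz
      · have h4 := h2 z hz
        rw [Pi.single_eq_of_ne fun h => hzx (congrArg Subtype.val h)] at h4
        refine ⟨h4, ?_⟩
        rw [← circle_zero_three hz, ← circle_one_two hz, add_comm]
        exact h4
  rw [← H.two_three (Ne.symm hxy), ← congrFun key, ← congrFun key]
  exact congrArg g (circle_zero_three hy)

theorem card_circle_eq_iff (H : D.IsSideSystem side) (hA : Subsingleton (D.Circle D.stateA))
    (d₀ : D.End) (s : D.State) :
    Fintype.card (D.Circle s) = D.numB s + 1 ↔ Noncrossing side s := by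
  rw [card_circle_eq_iff_surjective hA d₀]
  exact ⟨H.noncrossing_of_surjective hA, fun h => H.jumps_surjective h d₀⟩

/-- If the two arcs of the circle of `s_A D` cut at the chord at `x` are closed up by the
`B`-smoothing at `x`, then alternation with `x` is detected by `side x`. -/
theorem alternate_iff (H : D.IsSideSystem side) (hA : Subsingleton (D.Circle D.stateA))
    {x : Fin D.crossings}
    (h03 : (Quot.mk _ (x, 0) : D.CutCircle x) = Quot.mk _ (x, 3))
    (h12 : (Quot.mk _ (x, 1) : D.CutCircle x) = Quot.mk _ (x, 2)) (y : Fin D.crossings) :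
    D.Alternate x y ↔ side x (y, 0) ≠ side x (y, 2) := by
  have hside : ∀ d d' : D.End, d' = D.glue d ∨ (d.1 ≠ x ∧ d' = (d.1, smooth false d.2)) →
      side x d = side x d' := by
    rintro d d' (rfl | ⟨h, rfl⟩)
    · exact (H.glue x d).symm
    · exact (H.smooth_of_ne x d.1 d.2 h).symm
  refine not_congr ⟨fun h => congrArg (Quot.lift (side x) hside) h, fun h => ?_⟩
  classical
  by_contra hne
  let r : D.End → D.End → Prop :=
    fun d d' => d' = D.glue d ∨ (d.1 ≠ x ∧ d' = (d.1, smooth false d.2))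
  -- The indicator of the component of `(y, 0)`, assumed not to contain `(y, 2)`.
  let g : D.CutCircle x → ZMod 2 := fun c => if c = Quot.mk _ (y, 0) then 1 else 0
  let f : D.End → ZMod 2 := fun d => g (Quot.mk _ d)
  have hf : ∀ d, f (D.glue d) = f d := 
    fun d => congrArg g (Eq.symm (Quot.sound (r := r) (Or.inl rfl)))
  have hf' : ∀ z k, z ≠ x → f (z, smooth false k) = f (z, k) :=
    fun z k hz => congrArg g (Eq.symm (Quot.sound (r := r) (a := (z, k)) (Or.inr ⟨hz, rfl⟩)))
  have e1 : f (x, 0) = f (x, 3) := congrArg g h03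
  have e2 : f (x, 1) = f (x, 2) := congrArg g h12
  have s1 : side x (x, 0) = side x (x, 3) := H.smooth_self x 3
  have s2 : side x (x, 1) = side x (x, 2) := H.smooth_self x 2
  let c : ZMod 2 := f (x, 0) + f (x, 1)
  -- A function on the cut circle jumps only at `x`, and by the same amount `c` at both ends of the
  -- chord, so it is an affine function of `side x`.
  have key : f = fun d => c * side x d + (f (x, 0) - c * side x (x, 0)) := by
    refine eq_of_jumps hA (x, 0) hf (fun d => by rw [H.glue]) (by ring) fun z => ?_
    have t : ∀ a b p : ZMod 2, a * p + b + (a * p + b) = 0 := by decide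
    by_cases hz : z = x
    · subst hz
      have j : c * side z (z, 0) + (f (z, 0) - c * side z (z, 0)) +
          (c * side z (z, 1) + (f (z, 0) - c * side z (z, 0))) = c := by
        have t' : ∀ c r p q : ZMod 2, p + q = 1 → c * p + (r - c * p) + (c * q + (r - c * p)) = c := by
          decide
        exact t' _ _ _ _ (H.jump z)
      refine ⟨j.symm, ?_⟩
      rw [← e1, ← e2, ← s1, ← s2, add_comm]
      exact j.symm.trans (add_comm _ _)
    · have a1 : f (z, 1) = f (z, 0) := hf' z 0 hz
      have a2 : f (z, 3) = f (z, 2) := hf' z 2 hz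
      rw [a1, a2, H.zero_one hz, H.two_three hz, t, t]
      exact ⟨CharTwo.add_self_eq_zero _, CharTwo.add_self_eq_zero _⟩
  have h0 : f (y, 0) = 1 := if_pos rfl
  have h2 : f (y, 2) = 0 := if_neg fun h => hne h.symm
  have : f (y, 0) = f (y, 2) := by rw [key]; simp only [h]
  rw [h0, h2] at this
  exact absurd this (by decide)

end IsSideSystem

end OrientedLinkDiagram

/-! ### Cochains of finite simplicial complexes -/

namespace FinsetCochain

variable {V R : Type*} [CommRing R]

/-- A cochain is homogeneous of degree `k` if it is supported on the sets with `k` elements. -/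
def IsHomogeneous (k : ℤ) (φ : Finset V → R) : Prop := ∀ T, φ T ≠ 0 → (T.card : ℤ) = k

theorem IsHomogeneous.sub {k : ℤ} {φ ψ : Finset V → R} (hφ : IsHomogeneous k φ)
    (hψ : IsHomogeneous k ψ) : IsHomogeneous k (φ - ψ) := by
  intro T hT
  by_cases h0 : φ T = 0
  · exact hψ T fun h1 => hT (by rw [Pi.sub_apply, h0, h1, sub_zero])
  · exact hφ T h0

theorem IsHomogeneous.add {k : ℤ} {φ ψ : Finset V → R} (hφ : IsHomogeneous k φ)
    (hψ : IsHomogeneous k ψ) : IsHomogeneous k (φ + ψ) := by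
  intro T hT
  by_cases h0 : φ T = 0
  · exact hψ T fun h1 => hT (by rw [Pi.add_apply, h0, h1, add_zero])
  · exact hφ T h0

variable [LinearOrder V]

/-- The incidence sign of `T.erase x` in `T`. -/
def sign (R : Type*) [CommRing R] (T : Finset V) (x : V) : R :=
  (-1) ^ (T.filter fun y => x < y).card

/-- The coboundary operator of the full simplex. -/
def d (φ : Finset V → R) (T : Finset V) : R := ∑ x ∈ T, sign R T x * φ (T.erase x)

/-- The contraction of the cochain complex of a cone with apex `a`. -/
def h (a : V) (φ : Finset V → R) (S : Finset V) : R :=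
  if a ∈ S then 0 else sign R S a * φ (insert a S)

theorem sign_mul_self (T : Finset V) (x : V) : sign R T x * sign R T x = 1 := by
  rw [sign, ← mul_pow, neg_one_mul, neg_neg, one_pow]

theorem sign_insert_self (T : Finset V) (x : V) : sign R (insert x T) x = sign R T x := by
  rw [sign, sign, Finset.filter_insert, if_neg (lt_irrefl x)]

theorem sign_erase_self (T : Finset V) (x : V) : sign R (T.erase x) x = sign R T x := by
  rw [sign, sign, Finset.filter_erase, Finset.erase_eq_of_notMem]
  simp

theorem sign_insert {T : Finset V} {a x : V} (ha : a ∉ T) :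
    sign R (insert a T) x = if x < a then -sign R T x else sign R T x := by
  rw [sign, sign, Finset.filter_insert]
  split_ifs with hlt
  · rw [Finset.card_insert_of_notMem (by simp [ha]), pow_succ, mul_neg_one]
  · rfl

theorem sign_erase {T : Finset V} {a x : V} (hx : x ∈ T) :
    sign R (T.erase x) a = if a < x then -sign R T a else sign R T a := by
  have := sign_insert (R := R) (x := a) (Finset.notMem_erase x T)
  rw [Finset.insert_erase hx] at this
  rw [this]
  split_ifs
  · rw [neg_neg]
  · rfl

/-- `h a φ` vanishes on sets containing `a`, so only the face opposite to `a` contributes. -/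
theorem d_h_of_mem {a : V} {T : Finset V} (ha : a ∈ T) (φ : Finset V → R) :
    d (h a φ) T = φ T := by
  rw [d, Finset.sum_eq_single a]
  · rw [h, if_neg (Finset.notMem_erase a T), Finset.insert_erase ha, sign_erase_self, ← mul_assoc,
      sign_mul_self, one_mul]
  · intro x _ hxa
    rw [h, if_pos (Finset.mem_erase.2 ⟨Ne.symm hxa, ha⟩), mul_zero]
  · exact fun hn => absurd ha hn

theorem d_h_of_notMem {a : V} {T : Finset V} (ha : a ∉ T) (φ : Finset V → R) :
    d (h a φ) T = φ T - sign R T a * d φ (insert a T) := by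
  rw [d, d, Finset.sum_insert ha, Finset.erase_insert ha, sign_insert_self, mul_add, ← mul_assoc,
    sign_mul_self, one_mul, sub_add_eq_sub_sub, sub_self, zero_sub, Finset.mul_sum,
    ← Finset.sum_neg_distrib]
  refine Finset.sum_congr rfl fun x hx => ?_
  have hxa : x ≠ a := fun e => ha (e ▸ hx)
  rw [h, if_neg fun hm => ha (Finset.mem_of_mem_erase hm), sign_erase hx, sign_insert ha,
    Finset.erase_insert_of_ne (Ne.symm hxa)]
  rcases lt_or_gt_of_ne hxa with hlt | hlt
  · rw [if_neg hlt.not_gt, if_pos hlt]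
    ring
  · rw [if_pos hlt, if_neg hlt.not_gt]
    ring

theorem d_sub (φ ψ : Finset V → R) : d (φ - ψ) = d φ - d ψ := by
  funext T
  simp only [d, Pi.sub_apply, mul_sub, Finset.sum_sub_distrib]

theorem d_add (φ ψ : Finset V → R) : d (φ + ψ) = d φ + d ψ := by
  funext T
  simp only [d, Pi.add_apply, mul_add, Finset.sum_add_distrib]

theorem d_h_add_h_d (a : V) (φ : Finset V → R) : d (h a φ) + h a (d φ) = φ := by
  funext T
  rw [Pi.add_apply]
  by_cases ha : a ∈ T
  · rw [d_h_of_mem ha, h, if_pos ha, add_zero]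
  · rw [d_h_of_notMem ha, h, if_neg ha, sub_add_cancel]

/-- The homotopy formula gives `d (d (h a φ)) = h a (d (d φ))`. Evaluated at `T`, the left side
vanishes by induction, while the right side is, up to sign, `d (d φ)` at `insert a T`. -/
theorem d_d (φ : Finset V → R) : d (d φ) = 0 := by
  funext T
  induction T using Finset.induction_on generalizing φ with
  | empty => simp [d]
  | insert a T ha ih =>
    have h1 : d (d (h a φ)) + d (h a (d φ)) = d φ := by rw [← d_add, d_h_add_h_d]
    have h2 : d (d (h a φ)) = h a (d (d φ)) := by
      rw [eq_sub_of_add_eq h1, sub_eq_iff_eq_add, add_comm, d_h_add_h_d]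
    have h3 := congrFun h2 T
    rw [ih, h, if_neg ha] at h3
    have h4 := congrArg (sign R T a * ·) h3
    simp only [Pi.zero_apply, mul_zero, ← mul_assoc, sign_mul_self, one_mul] at h4
    exact h4.symm

theorem IsHomogeneous.d {k : ℤ} {φ : Finset V → R} (hφ : IsHomogeneous k φ) :
    IsHomogeneous (k + 1) (d φ) := by
  intro T hT
  obtain ⟨x, hx, hne⟩ := Finset.exists_ne_zero_of_sum_ne_zero hT
  rw [← hφ _ (right_ne_zero_of_mul hne), ← Finset.card_erase_add_one hx]
  push_cast
  rfl

theorem IsHomogeneous.h {k : ℤ} {φ : Finset V → R} (hφ : IsHomogeneous k φ) (a : V) :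
    IsHomogeneous (k - 1) (h a φ) := by
  intro T hT
  unfold FinsetCochain.h at hT
  split_ifs at hT with ha
  · exact absurd rfl hT
  · rw [← hφ _ (right_ne_zero_of_mul hT), Finset.card_insert_of_notMem ha]
    push_cast
    ring

/-- A decomposition of a simplicial complex `F` into blocks with increasing numbers, such that
the blocks with a number `m < N` are closed under inserting and erasing the vertex `apex m`. -/
structure IsToggling (F : Set (Finset V)) (block : Finset V → ℕ) (apex : ℕ → V) (N : ℕ) :
    Prop where
  down : ∀ {S T}, S ⊆ T → T ∈ F → S ∈ F
  mono : ∀ {S T}, S ⊆ T → T ∈ F → block S ≤ block T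
  insert_mem : ∀ {m T}, m < N → T ∈ F → block T = m → insert (apex m) T ∈ F
  block_insert : ∀ {m T}, m < N → T ∈ F → block T = m → block (insert (apex m) T) = m
  block_erase : ∀ {m T}, m < N → T ∈ F → block T = m → block (T.erase (apex m)) = m

variable {F : Set (Finset V)} {block : Finset V → ℕ} {apex : ℕ → V} {N : ℕ}

open Classical in
-- Contracting towards `apex m` inside block `m` solves the equation there. Since `block` is
-- monotone, faces of sets in lower blocks lie in lower blocks, where the solution is zero, so
-- nothing changes below `m`.
theorem IsToggling.exists_d_eq (H : IsToggling F block apex N) {m : ℕ} (hm : m < N) {k : ℤ}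
    {φ : Finset V → R} (hk : IsHomogeneous k φ) (h0 : ∀ T ∈ F, block T < m → φ T = 0)
    (h1 : ∀ T ∈ F, block T = m → d φ T = 0) :
    ∃ ψ : Finset V → R, IsHomogeneous (k - 1) ψ ∧ ∀ T ∈ F, block T ≤ m → d ψ T = φ T := by
  let φm : Finset V → R := fun T => if T ∈ F ∧ block T = m then φ T else 0
  have hkm : IsHomogeneous k φm := fun T hT => hk T fun h => hT (by simp [φm, h])
  have hψ : ∀ S, block S ≠ m → h (apex m) φm S = 0 := by
    intro S hS
    unfold h
    split_ifs with ha
    · rfl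
    · have : φm (insert (apex m) S) = 0 := by
        refine if_neg fun hins => hS ?_
        have := H.block_erase hm hins.1 hins.2
        rwa [Finset.erase_insert ha] at this
      rw [this, mul_zero]
  refine ⟨h (apex m) φm, hkm.h _, fun T hT hb => ?_⟩
  rcases hb.lt_or_eq with hlt | rfl
  · rw [h0 T hT hlt]
    refine Finset.sum_eq_zero fun x _ => ?_
    rw [hψ, mul_zero]
    exact ((H.mono (T.erase_subset x) hT).trans_lt hlt).ne
  · have hT' : φm T = φ T := if_pos ⟨hT, rfl⟩
    by_cases ha : apex (block T) ∈ T
    · rw [d_h_of_mem ha, hT']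
    · have hi := H.insert_mem hm hT rfl
      have hib := H.block_insert hm hT rfl
      -- Every face lies in block `m` or lower, and `φ` vanishes lower down, so the truncation is
      -- invisible to `d` here.
      have : d φm (insert (apex (block T)) T) = d φ (insert (apex (block T)) T) := by
        refine Finset.sum_congr rfl fun x _ => congrArg _ ?_
        have hF := H.down (Finset.erase_subset x _) hi
        have hle := H.mono (Finset.erase_subset x _) hi
        rw [hib] at hle
        rcases hle.lt_or_eq with hlt | heq
        · exact (if_neg fun h => hlt.ne h.2).trans (h0 _ hF hlt).symm
        · exact if_pos ⟨hF, heq⟩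
      rw [d_h_of_notMem ha, hT', this, h1 _ hi hib, mul_zero, sub_zero]

/-- The blocks are cleared in increasing order. The cocycle condition is required only below `N`,
which is what the injectivity argument in `IsSideSystem.nonempty_khovanov_equiv` can supply. -/
theorem IsToggling.exists_sub_d_eq_zero (H : IsToggling F block apex N) {k : ℤ}
    {φ : Finset V → R} (hk : IsHomogeneous k φ) (h1 : ∀ T ∈ F, block T < N → d φ T = 0) :
    ∃ ψ : Finset V → R, IsHomogeneous (k - 1) ψ ∧ ∀ T ∈ F, block T < N → φ T = d ψ T := by
  suffices ∀ m ≤ N, ∃ ψ : Finset V → R, IsHomogeneous (k - 1) ψ ∧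
      ∀ T ∈ F, block T < m → φ T = d ψ T from this N le_rfl
  intro m
  induction m with
  | zero => exact fun _ => ⟨0, fun T hT => absurd rfl hT, fun T _ h => absurd h (Nat.not_lt_zero _)⟩
  | succ m ih =>
    intro hm
    obtain ⟨ψ, hψk, hψ⟩ := ih (Nat.le_of_succ_le hm)
    have hd : IsHomogeneous k (d ψ) := by simpa using hψk.d
    obtain ⟨χ, hχk, hχ⟩ := H.exists_d_eq (m := m) hm (φ := φ - d ψ) (hk.sub hd)
      (fun T hT hb => sub_eq_zero.2 (hψ T hT hb)) fun T hT hb => by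
        rw [d_sub, d_d, sub_zero]
        exact h1 T hT (hb ▸ hm)
    refine ⟨ψ + χ, hψk.add hχk, fun T hT hb => ?_⟩
    rw [d_add, Pi.add_apply, hχ T hT (Nat.lt_succ_iff.1 hb), Pi.sub_apply, add_sub_cancel]

end FinsetCochain

namespace OrientedLinkDiagram

variable {D : OrientedLinkDiagram} {side : Fin D.crossings → D.End → ZMod 2}

/-! ### The extreme enhanced states -/

theorem neg_card_le_tau (S : D.EnhancedState) : -(Fintype.card (D.Circle S.1) : ℤ) ≤ D.tau S := by
  have : ∑ _k : D.Circle S.1, (-1 : ℤ) ≤ D.tau S :=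
    Finset.sum_le_sum fun k _ => by rcases Int.units_eq_one_or (S.2 k) with h | h <;> simp [h]
  simpa using this

theorem tau_eq_neg_card_iff (S : D.EnhancedState) :
    D.tau S = -(Fintype.card (D.Circle S.1) : ℤ) ↔ ∀ k, S.2 k = -1 := by
  have hle : ∀ k ∈ (Finset.univ : Finset (D.Circle S.1)), (-1 : ℤ) ≤ ((S.2 k : ℤˣ) : ℤ) :=
    fun k _ => by rcases Int.units_eq_one_or (S.2 k) with h | h <;> simp [h]
  have := Finset.sum_eq_sum_iff_of_le hle
  rw [Finset.sum_const, Finset.card_univ, smul_neg, nsmul_one] at this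
  rw [tau, eq_comm, this]
  refine ⟨fun h k => ?_, fun h k _ => by rw [h k]; rfl⟩
  rcases Int.units_eq_one_or (S.2 k) with h1 | h1
  · have := h k (Finset.mem_univ k)
    rw [h1] at this
    exact absurd this (by decide)
  · exact h1

/-- The least possible value of `j` when `s_A D` is a single circle. -/
def extremeJ (D : OrientedLinkDiagram) : ℤ := D.writhe - D.numNeg - 1

theorem extremeJ_le_degJ (hA : Subsingleton (D.Circle D.stateA)) (d₀ : D.End)
    (S : D.EnhancedState) : D.extremeJ ≤ D.degJ S := by
  have h1 := neg_card_le_tau S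
  have h2 := card_circle_le hA d₀ S.1
  rw [extremeJ, degJ, degI_eq]
  omega

/-- Two bounds add up to the bound on `j`: that on the number of circles and that on the sum of
signs. Both must be sharp. -/
theorem IsSideSystem.degJ_eq_iff (H : D.IsSideSystem side)
    (hA : Subsingleton (D.Circle D.stateA)) (d₀ : D.End) (S : D.EnhancedState) :
    D.degJ S = D.extremeJ ↔ Noncrossing side S.1 ∧ ∀ k, S.2 k = -1 := by
  have h1 := neg_card_le_tau S
  have h2 := card_circle_le hA d₀ S.1
  rw [← H.card_circle_eq_iff hA d₀, ← tau_eq_neg_card_iff, extremeJ, degJ, degI_eq]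
  omega

/-- The set of the `B`-labelled crossings. -/
def supp (s : D.State) : Finset (Fin D.crossings) := Finset.univ.filter fun x => s x = true

theorem mem_supp {s : D.State} {x : Fin D.crossings} : x ∈ supp s ↔ s x = true := by
  simp [supp]

theorem supp_injective : Function.Injective (supp : D.State → _) := by
  intro s t h
  funext x
  rw [Bool.eq_iff_iff, ← mem_supp, h, mem_supp]

theorem supp_decide (T : Finset (Fin D.crossings)) :
    supp (fun x => decide (x ∈ T) : D.State) = T := by
  ext x
  simp [mem_supp]

/-- The sets of crossings whose chords do not alternate pairwise. -/
def noncrossingSets (side : Fin D.crossings → D.End → ZMod 2) : Set (Finset (Fin D.crossings)) :=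
  {T | ∀ x ∈ T, ∀ y ∈ T, x ≠ y → side x (y, 0) = side x (y, 2)}

theorem supp_mem_noncrossingSets {s : D.State} :
    supp s ∈ noncrossingSets side ↔ Noncrossing side s := by
  simp only [noncrossingSets, Set.mem_ofPred_eq, mem_supp, Noncrossing]
  exact ⟨fun h x y hx hy => h x hx y hy, fun h x hx y hy => h x y hx hy⟩

variable {i : ℤ}

theorem Generator.card_supp {j : ℤ} (g : D.Generator i j) :
    ((supp g.1.1).card : ℤ) = i + D.numNeg := by
  have := g.2.1
  rw [degI_eq] at this
  change (D.numB g.1.1 : ℤ) = _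
  omega

section Extreme

variable (H : D.IsSideSystem side) (hA : Subsingleton (D.Circle D.stateA)) (d₀ : D.End)

include H hA d₀

theorem IsSideSystem.generator_ext {g g' : D.Generator i D.extremeJ}
    (h : supp g.1.1 = supp g'.1.1) : g = g' := by
  obtain ⟨⟨s, e⟩, hg⟩ := g
  obtain ⟨⟨s', e'⟩, hg'⟩ := g'
  obtain rfl : s = s' := supp_injective h
  obtain rfl : e = e' := funext fun k =>
    (((H.degJ_eq_iff hA d₀ _).1 hg.2).2 k).trans (((H.degJ_eq_iff hA d₀ _).1 hg'.2).2 k).symm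
  rfl

theorem IsSideSystem.supp_mem (g : D.Generator i D.extremeJ) :
    supp g.1.1 ∈ noncrossingSets side :=
  supp_mem_noncrossingSets.2 ((H.degJ_eq_iff hA d₀ _).1 g.2.2).1

theorem IsSideSystem.exists_generator {T : Finset (Fin D.crossings)}
    (hT : T ∈ noncrossingSets side) (hc : (T.card : ℤ) = i + D.numNeg) :
    ∃ g : D.Generator i D.extremeJ, supp g.1.1 = T := by
  refine ⟨⟨⟨fun x => decide (x ∈ T), fun _ => -1⟩, ?_, ?_⟩, supp_decide T⟩
  · have : D.numB (fun x => decide (x ∈ T)) = T.card := congrArg Finset.card (supp_decide T)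
    rw [degI_eq]
    dsimp only
    rw [this]
    omega
  · refine (H.degJ_eq_iff hA d₀ _).2 ⟨?_, fun _ => rfl⟩
    rw [← supp_mem_noncrossingSets, supp_decide]
    exact hT

/-- All signs are `-1` in the extreme degree, so the condition on signs is automatic. The separate
index `i'` also serves the differential from `i - 1` to `i`, where `i - 1 + 1` is not syntactically
`i`. -/
theorem IsSideSystem.adjacentAt_iff {i' : ℤ} (hi : i' = i + 1) (g : D.Generator i D.extremeJ)
    (g' : D.Generator i' D.extremeJ) (x : Fin D.crossings) :
    D.AdjacentAt g.1 g'.1 x ↔ x ∈ supp g'.1.1 ∧ supp g.1.1 = (supp g'.1.1).erase x := by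
  constructor
  · rintro ⟨-, -, h1, h2, h3, -⟩
    refine ⟨mem_supp.2 h2, ?_⟩
    ext y
    rw [Finset.mem_erase, mem_supp, mem_supp]
    by_cases hy : y = x
    · simp [hy, h1]
    · simp [hy, h3 y hy]
  · rintro ⟨h1, h2⟩
    have h3 : ∀ y, g.1.1 y = true ↔ y ≠ x ∧ g'.1.1 y = true := fun y => by
      rw [← mem_supp, h2, Finset.mem_erase, mem_supp]
    refine ⟨by rw [g.2.1, g'.2.1, hi], by rw [g.2.2, g'.2.2], ?_, mem_supp.1 h1, ?_, ?_⟩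
    · exact Bool.eq_false_iff.2 fun h => ((h3 x).1 h).1 rfl
    · intro y hy
      rw [Bool.eq_iff_iff, h3 y]
      exact ⟨fun h => ⟨hy, h⟩, fun h => h.2⟩
    · intro d _
      rw [((H.degJ_eq_iff hA d₀ _).1 g.2.2).2, ((H.degJ_eq_iff hA d₀ _).1 g'.2.2).2]

theorem IsSideSystem.incidence_eq (R : Type*) [CommRing R] {i' : ℤ} (hi : i' = i + 1)
    (g : D.Generator i D.extremeJ) (g' : D.Generator i' D.extremeJ) :
    ((D.incidence g.1 g'.1 : ℤ) : R) = ∑ x ∈ supp g'.1.1,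
      if supp g.1.1 = (supp g'.1.1).erase x then FinsetCochain.sign R (supp g'.1.1) x else 0 := by
  rw [incidence, Int.cast_sum, supp, Finset.sum_filter]
  refine Finset.sum_congr rfl fun x _ => ?_
  have hiff := H.adjacentAt_iff hA d₀ hi g g' x
  rw [mem_supp] at hiff
  by_cases hx : g'.1.1 x = true
  · rw [if_pos hx]
    by_cases he : supp g.1.1 = (supp g'.1.1).erase x
    · have : (Finset.univ.filter fun y => x < y ∧ g.1.1 y = true) =
          ((supp g'.1.1).erase x).filter fun y => x < y := by
        rw [← he]
        ext y
        simp [supp, and_comm]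
      rw [if_pos (hiff.2 ⟨hx, he⟩), this, ← FinsetCochain.sign_erase_self]
      refine Eq.trans ?_ (if_pos he).symm
      rw [FinsetCochain.sign]
      push_cast
      rfl
    · rw [if_neg fun h => he (hiff.1 h).2, Int.cast_zero]
      exact (if_neg he).symm
  · rw [if_neg hx, if_neg fun h => hx (hiff.1 h).1, Int.cast_zero]

end Extreme

/-- The restriction of a cochain of the full simplex to the enhanced states of bidegree
`(i, j)`. -/
noncomputable def restrict {R : Type*} [CommRing R] (i j : ℤ) (φ : Finset (Fin D.crossings) → R) :
    D.Chain R i j :=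
  Finsupp.equivFunOnFinite.symm fun g => φ (supp g.1.1)

variable {R : Type*} [CommRing R]

theorem restrict_apply {j : ℤ} (φ : Finset (Fin D.crossings) → R) (g : D.Generator i j) :
    restrict i j φ g = φ (supp g.1.1) := rfl

section Extreme

variable (H : D.IsSideSystem side) (hA : Subsingleton (D.Circle D.stateA)) (d₀ : D.End)

include H hA d₀

theorem IsSideSystem.restrict_eq_iff {φ ψ : Finset (Fin D.crossings) → R} :
    restrict i D.extremeJ φ = restrict i D.extremeJ ψ ↔
      ∀ T ∈ noncrossingSets side, (T.card : ℤ) = i + D.numNeg → φ T = ψ T := by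
  refine ⟨fun h T hT hc => ?_, fun h => Finsupp.ext fun g => ?_⟩
  · obtain ⟨g, rfl⟩ := H.exists_generator hA d₀ hT hc
    exact DFunLike.congr_fun h g
  · exact h _ (H.supp_mem hA d₀ g) g.card_supp

theorem IsSideSystem.exists_restrict_eq (c : D.Chain R i D.extremeJ) :
    ∃ φ, FinsetCochain.IsHomogeneous (i + D.numNeg) φ ∧ restrict i D.extremeJ φ = c := by
  have hinj : Function.Injective fun g : D.Generator i D.extremeJ => supp g.1.1 :=
    fun g g' h => H.generator_ext hA d₀ h
  -- The default value `0` off the generators makes the extension homogeneous.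
  refine ⟨Function.extend (fun g : D.Generator i D.extremeJ => supp g.1.1) c 0, ?_, ?_⟩
  · intro T hT
    by_cases h : ∃ g : D.Generator i D.extremeJ, supp g.1.1 = T
    · obtain ⟨g, rfl⟩ := h
      exact g.card_supp
    · exact absurd (Function.extend_apply' _ _ _ h) hT
  · ext g
    exact hinj.extend_apply _ _ g

/-- Noncrossing sets are closed under taking subsets, so every face in the simplicial coboundary
comes from exactly one generator. -/
theorem IsSideSystem.differential_restrict {i' : ℤ} (hi : i' = i + 1)
    (φ : Finset (Fin D.crossings) → R) :
    D.differential R i i' D.extremeJ (restrict i D.extremeJ φ) =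
      restrict i' D.extremeJ (FinsetCochain.d φ) := by
  classical
  ext g'
  have : Fintype (D.Generator i D.extremeJ) := Fintype.ofFinite _
  rw [differential, Finsupp.linearCombination_apply, Finsupp.sum_fintype _ _ (by simp),
    Finsupp.finsetSum_apply, restrict_apply, FinsetCochain.d]
  simp only [Finsupp.smul_apply, restrict_apply, smul_eq_mul, Finsupp.equivFunOnFinite_symm_apply_apply,
    H.incidence_eq hA d₀ R hi, Finset.mul_sum]
  rw [Finset.sum_comm]
  refine Finset.sum_congr rfl fun x hx => ?_
  have hF : (supp g'.1.1).erase x ∈ noncrossingSets side := fun y hy z hz =>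
    H.supp_mem hA d₀ g' y (Finset.mem_of_mem_erase hy) z (Finset.mem_of_mem_erase hz)
  have hc : (((supp g'.1.1).erase x).card : ℤ) = i + D.numNeg := by
    have h1 := g'.card_supp
    have h2 := Finset.card_erase_add_one hx
    omega
  obtain ⟨g, hg⟩ := H.exists_generator hA d₀ hF hc
  rw [Finset.sum_eq_single g, if_pos hg, hg, mul_comm]
  · intro g₁ _ hne
    rw [if_neg fun h => hne (H.generator_ext hA d₀ (h.trans hg.symm)), mul_zero]
  · exact fun h => absurd (Finset.mem_univ g) h

end Extreme

end OrientedLinkDiagram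

/-! ### Extreme cohomology from the critical sets of a toggling. -/

namespace OrientedLinkDiagram

variable {D : OrientedLinkDiagram} {side : Fin D.crossings → D.End → ZMod 2} {i : ℤ}
  {R : Type*} [CommRing R]

theorem smul_restrict {j : ℤ} (r : R) (φ : Finset (Fin D.crossings) → R) :
    r • restrict (D := D) i j φ = restrict i j (r • φ) :=
  Finsupp.ext fun _ => rfl

theorem restrict_zero {j : ℤ} : restrict (D := D) (R := R) i j 0 = 0 :=
  Finsupp.ext fun _ => rfl

section Cohomology

variable (H : D.IsSideSystem side) (hA : Subsingleton (D.Circle D.stateA)) (d₀ : D.End)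
  {block : Finset (Fin D.crossings) → ℕ} {apex : ℕ → Fin D.crossings} {N : ℕ}
  (HT : FinsetCochain.IsToggling (noncrossingSets side) block apex N)

include H hA d₀ HT

theorem IsSideSystem.exists_critical_representative (c : D.Chain R i D.extremeJ)
    (hc : D.differential R i (i + 1) D.extremeJ c = 0) :
    ∃ φ : Finset (Fin D.crossings) → R,
      (∀ T ∈ noncrossingSets side, block T < N → φ T = 0) ∧
      ∃ b, D.differential R (i - 1) i D.extremeJ b = c - restrict i D.extremeJ φ := by
  obtain ⟨φ, hφ, rfl⟩ := H.exists_restrict_eq hA d₀ c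
  rw [H.differential_restrict hA d₀ rfl, ← restrict_zero, H.restrict_eq_iff hA d₀] at hc
  -- The hypothesis speaks only of sets with `i + 1 + n` elements; homogeneity covers all other
  -- sizes.
  have hd : ∀ T ∈ noncrossingSets side, FinsetCochain.d φ T = 0 := by
    intro T hT
    by_contra hne
    refine hne (hc T hT ?_)
    rw [hφ.d T hne]
    ring
  obtain ⟨ψ, -, hψ⟩ := HT.exists_sub_d_eq_zero hφ fun T hT _ => hd T hT
  refine ⟨φ - FinsetCochain.d ψ, fun T hT hb => sub_eq_zero.2 (hψ T hT hb),
    restrict (i - 1) D.extremeJ ψ, ?_⟩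
  rw [H.differential_restrict hA d₀ (by ring)]
  ext g
  simp only [Finsupp.sub_apply, restrict_apply, Pi.sub_apply, sub_sub_cancel]

theorem IsSideSystem.subsingleton_khovanov
    (h : ∀ T ∈ noncrossingSets side, (T.card : ℤ) = i + D.numNeg → block T < N) :
    Subsingleton (D.Khovanov R i D.extremeJ) := by
  refine Submodule.Quotient.subsingleton_iff.2 (eq_top_iff.2 ?_)
  rintro ⟨c, hc⟩ -
  obtain ⟨φ, hφ, b, hb⟩ := H.exists_critical_representative hA d₀ HT c hc
  have : restrict i D.extremeJ φ = restrict i D.extremeJ 0 :=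
    (H.restrict_eq_iff hA d₀).2 fun T hT hcard => hφ T hT (h T hT hcard)
  refine ⟨b, hb.trans ?_⟩
  rw [this, restrict_zero]
  exact sub_zero c

/-- The class of the indicator of `T₀` is a basis. It generates because cocycles can be reduced to
critical sets. If `r` times it is a coboundary `d φ`, then `φ` can be reduced to critical sets too,
and the result is a cocycle by maximality, so `r = 0`. -/
theorem IsSideSystem.nonempty_khovanov_equiv {T₀ : Finset (Fin D.crossings)}
    (hT₀ : T₀ ∈ noncrossingSets side) (hcard : (T₀.card : ℤ) = i + D.numNeg)
    (hcrit : N ≤ block T₀)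
    (huniq : ∀ T ∈ noncrossingSets side, (T.card : ℤ) = i + D.numNeg → N ≤ block T → T = T₀)
    (hmax : ∀ S T, S ⊆ T → T ∈ noncrossingSets side → N ≤ block S → S = T) :
    Nonempty (D.Khovanov R i D.extremeJ ≃ₗ[R] R) := by
  classical
  let δ : Finset (Fin D.crossings) → R := Pi.single T₀ 1
  -- critical sets are maximal, so that cochains supported on them are cocycles
  have hcocycle : ∀ φ : Finset (Fin D.crossings) → R,
      (∀ T ∈ noncrossingSets side, block T < N → φ T = 0) →
      ∀ T ∈ noncrossingSets side, FinsetCochain.d φ T = 0 := by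
    intro φ hφ T hT
    refine Finset.sum_eq_zero fun x hx => ?_
    rw [hφ _ (HT.down (T.erase_subset x) hT), mul_zero]
    by_contra hN
    have := hmax _ _ (T.erase_subset x) hT (not_lt.1 hN)
    exact Finset.notMem_erase x T (this.symm ▸ hx)
  have hδ : ∀ T ∈ noncrossingSets side, block T < N → δ T = 0 := fun T _ hb =>
    Pi.single_eq_of_ne (fun h => (h ▸ hb).not_ge hcrit) 1
  have hker : restrict i D.extremeJ δ ∈ LinearMap.ker (D.differential R i (i + 1) D.extremeJ) := by
    rw [LinearMap.mem_ker, H.differential_restrict hA d₀ rfl, ← restrict_zero,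
      H.restrict_eq_iff hA d₀]
    exact fun T hT _ => hcocycle δ hδ T hT
  let ρ : R →ₗ[R] D.Khovanov R i D.extremeJ := LinearMap.toSpanSingleton R _
    (Submodule.Quotient.mk ⟨restrict i D.extremeJ δ, hker⟩)
  have hρ : ∀ r, ρ r = Submodule.Quotient.mk (r • ⟨restrict i D.extremeJ δ, hker⟩) := fun _ => rfl
  refine ⟨(LinearEquiv.ofBijective ρ ⟨?_, ?_⟩).symm⟩
  · refine (injective_iff_map_eq_zero ρ).2 fun r hr => ?_
    rw [hρ, Submodule.Quotient.mk_eq_zero] at hr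
    obtain ⟨b, hb⟩ := hr
    change _ = r • restrict i D.extremeJ δ at hb
    obtain ⟨φ, hφ, rfl⟩ := H.exists_restrict_eq hA d₀ b
    rw [H.differential_restrict hA d₀ (by ring), smul_restrict, H.restrict_eq_iff hA d₀] at hb
    -- Here `φ` is no cocycle, but `d φ` agrees with `r • δ`, which vanishes off the critical sets.
    have hd : ∀ T ∈ noncrossingSets side, block T < N → FinsetCochain.d φ T = 0 := by
      intro T hT hlt
      by_contra hne
      have h1 : (T.card : ℤ) = i + D.numNeg := by
        rw [hφ.d T hne]
        ring
      refine hne ((hb T hT h1).trans ?_)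
      rw [Pi.smul_apply, hδ T hT hlt, smul_zero]
    obtain ⟨ψ, -, hψ⟩ := HT.exists_sub_d_eq_zero hφ hd
    have h0 := hcocycle (φ - FinsetCochain.d ψ) (fun T hT hlt => sub_eq_zero.2 (hψ T hT hlt)) T₀ hT₀
    rw [FinsetCochain.d_sub, FinsetCochain.d_d, sub_zero, hb T₀ hT₀ hcard] at h0
    simpa [δ] using h0
  · intro k
    obtain ⟨⟨c, hc⟩, rfl⟩ := Submodule.Quotient.mk_surjective _ k
    obtain ⟨φ, hφ, b, hb⟩ := H.exists_critical_representative hA d₀ HT c hc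
    refine ⟨φ T₀, ?_⟩
    rw [hρ, eq_comm, Submodule.Quotient.eq]
    refine ⟨b, hb.trans (congrArg (c - ·) ?_)⟩
    change _ = φ T₀ • restrict i D.extremeJ δ
    rw [smul_restrict, H.restrict_eq_iff hA d₀]
    intro T hT hcT
    by_cases hlt : block T < N
    · rw [hφ T hT hlt, Pi.smul_apply, hδ T hT hlt, smul_zero]
    · obtain rfl := huniq T hT hcT (not_lt.1 hlt)
      simp [δ]

end Cohomology

end OrientedLinkDiagram

namespace TwoHexagonDiagram

/-! ### A diagram with the Lando graph of two hexagons sharing a vertex -/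

/-- The positions of the strand ends on the single circle of the state `s_A`, numbered in the order
in which they are met on it. -/
def pos : Fin 11 × Fin 4 → Fin 44 := fun d =>
  ![![0, 1, 10, 11], ![9, 8, 15, 14], ![12, 13, 18, 19], ![17, 16, 23, 22], ![26, 27, 20, 21],
    ![7, 6, 25, 24], ![5, 4, 31, 30], ![28, 29, 34, 35], ![33, 32, 39, 38], ![42, 43, 36, 37],
    ![3, 2, 41, 40]] d.1 d.2

/-- The inverse of `pos`. -/
def endAt : Fin 44 → Fin 11 × Fin 4 :=
  ![(0, 0), (0, 1), (10, 1), (10, 0), (6, 1), (6, 0), (5, 1), (5, 0), (1, 1), (1, 0), (0, 2),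
    (0, 3), (2, 0), (2, 1), (1, 3), (1, 2), (3, 1), (3, 0), (2, 2), (2, 3), (4, 2), (4, 3),
    (3, 3), (3, 2), (5, 3), (5, 2), (4, 0), (4, 1), (7, 0), (7, 1), (6, 3), (6, 2), (8, 1),
    (8, 0), (7, 2), (7, 3), (9, 2), (9, 3), (8, 3), (8, 2), (10, 3), (10, 2), (9, 0), (9, 1)]

/-- The smoothing arcs join the positions `2 m` and `2 m + 1`, the arcs of the diagram join
`2 m + 1` and `2 m + 2`. -/
def glue (d : Fin 11 × Fin 4) : Fin 11 × Fin 4 :=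
  endAt (if (pos d).val % 2 = 0 then pos d - 1 else pos d + 1)

/-- The code of the diagram: the crossings `0`, `3` and `8` are negative. -/
def code : OrientedDiagramCode where
  crossings := 11
  positive x := decide (x ≠ 0 ∧ x ≠ 3 ∧ x ≠ 8)
  glue := glue
  glue_involutive := by
    have : ∀ d, glue (glue d) = d := by decide +kernel
    exact this
  glue_oriented := by decide +kernel

/-- The face to the left of an end. -/
def face : Fin 11 × Fin 4 → Fin 13 := fun d =>
  ![![0, 1, 2, 3], ![1, 4, 5, 2], ![2, 5, 6, 3], ![5, 4, 7, 6], ![8, 3, 6, 7], ![1, 8, 7, 4],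
    ![1, 9, 10, 8], ![8, 10, 11, 3], ![10, 9, 12, 11], ![0, 3, 11, 12], ![1, 0, 12, 9]] d.1 d.2

/-- A corner of each face. -/
def corner : Fin 13 → Fin 11 × Fin 4 :=
  ![(0, 0), (0, 1), (0, 2), (0, 3), (1, 1), (1, 2), (2, 2), (3, 2), (4, 0), (6, 1), (6, 2),
    (7, 2), (8, 2)]

/-- The next corner of a face. -/
def next (d : Fin 11 × Fin 4) : Fin 11 × Fin 4 := ((glue d).1, (glue d).2 - 1)

theorem mk_iterate {α : Type*} (r : α → α → Prop) (f : α → α) (hf : ∀ a, r a (f a)) (n : ℕ)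
    (a : α) : Quot.mk r (f^[n] a) = Quot.mk r a := by
  induction n with
  | zero => rfl
  | succ n ih =>
    rw [Function.iterate_succ_apply', ← ih]
    exact (Quot.sound (hf _)).symm

theorem face_next : ∀ d, face (next d) = face d := by decide +kernel

theorem face_corner : ∀ m, face (corner m) = m := by decide +kernel

/-- No face has more than five corners. -/
theorem exists_iterate_next : ∀ d, ∃ n : Fin 5, next^[n] (corner (face d)) = d := by
  decide +kernel

theorem card_face : Nat.card code.Face = 13 := by
  rw [← Nat.card_fin 13]
  refine Nat.card_congr
    { toFun := Quot.lift face fun d d' (h : d' = next d) =>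
        (face_next d).symm.trans (congrArg face h.symm)
      invFun := fun m => Quot.mk _ (corner m)
      left_inv := ?_
      right_inv := face_corner }
  intro k
  induction k using Quot.ind with
  | mk d =>
    obtain ⟨n, hn⟩ := exists_iterate_next d
    let r : Fin 11 × Fin 4 → Fin 11 × Fin 4 → Prop := fun d d' => d' = next d
    have := mk_iterate r next (fun _ => rfl) n (corner (face d))
    exact this.symm.trans (congrArg (Quot.mk r) hn)

/-! ### The walk around the circle of `s_A`, connectedness and the chords. -/

/-- The strand ends in their cyclic order on the circle of `s_A`. -/
def endAtNat (m : ℕ) : Fin 11 × Fin 4 := endAt (Fin.ofNat 44 m)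

theorem endAtNat_pos : ∀ d, endAtNat (pos d).val = d := by decide +kernel

theorem endAtNat_add (m : ℕ) : endAtNat (m + 44) = endAtNat m := by
  unfold endAtNat
  congr 1
  simp [Fin.ext_iff]

theorem endAtNat_succ_of_lt : ∀ m < 44, endAtNat (m + 1) = glue (endAtNat m) ∨
    m % 2 = 0 ∧
      endAtNat (m + 1) = ((endAtNat m).1, OrientedLinkDiagram.smooth false (endAtNat m).2) := by
  decide +kernel

theorem endAtNat_succ (m : ℕ) : endAtNat (m + 1) = glue (endAtNat m) ∨
    m % 2 = 0 ∧
      endAtNat (m + 1) = ((endAtNat m).1, OrientedLinkDiagram.smooth false (endAtNat m).2) := by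
  induction m using Nat.strong_induction_on with
  | _ m ih =>
    by_cases hm : m < 44
    · exact endAtNat_succ_of_lt m hm
    · obtain ⟨n, rfl⟩ := Nat.exists_eq_add_of_le' (not_lt.1 hm)
      have := ih n (by omega)
      rw [add_right_comm, endAtNat_add, endAtNat_add]
      rwa [show (n + 44) % 2 = n % 2 by omega]

theorem eq_endAtNat_add {β : Type*} (F : Fin 11 × Fin 4 → β) (p n : ℕ)
    (h : ∀ m < n, F (endAtNat (p + m)) = F (endAtNat (p + m + 1))) :
    F (endAtNat p) = F (endAtNat (p + n)) := by
  induction n with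
  | zero => rfl
  | succ n ih =>
    rw [ih fun m hm => h m (hm.trans n.lt_succ_self)]
    exact h n n.lt_succ_self

/-- Walking along the circle from position `0` reaches every end. This serves both for the circle of
`s_A` and for the connectedness of the diagram. -/
theorem eq_of_invariant {β : Type*} (F : Fin 11 × Fin 4 → β) (hg : ∀ d, F d = F (glue d))
    (hs : ∀ d : Fin 11 × Fin 4, F d = F (d.1, OrientedLinkDiagram.smooth false d.2))
    (d d' : Fin 11 × Fin 4) : F d = F d' := by
  have : ∀ d, F (endAtNat 0) = F d := fun d => by
    rw [← endAtNat_pos d, ← zero_add (pos d).val]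
    refine eq_endAtNat_add F 0 _ fun m _ => ?_
    rcases endAtNat_succ (0 + m) with h | ⟨-, h⟩
    · rw [h, ← hg]
    · rw [h, ← hs]
  exact (this d).symm.trans (this d')

theorem card_piece : Nat.card code.Piece = 1 := by
  let r : code.End → code.End → Prop := fun d d' => d' = code.glue d ∨ d' = (d.1, d.2 + 1)
  have hr : ∀ x k, Quot.mk r (x, k + 1) = Quot.mk r (x, k) := fun x k =>
    (Quot.sound (r := r) (a := (x, k)) (Or.inr rfl)).symm
  have h0 : ∀ x k, Quot.mk r (x, k) = Quot.mk r (x, 0) := fun x k => by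
    have h1 := hr x 0
    have h2 := hr x 1
    have h3 := hr x 2
    fin_cases k
    · rfl
    · exact h1
    · exact h2.trans h1
    · exact h3.trans (h2.trans h1)
  refine Nat.card_eq_one_iff_unique.2 ⟨⟨fun a b => ?_⟩, ⟨Quot.mk _ (endAtNat 0)⟩⟩
  induction a using Quot.ind with
  | mk a =>
    induction b using Quot.ind with
    | mk b =>
      exact eq_of_invariant (Quot.mk r) (fun d => Quot.sound (Or.inl rfl))
        (fun d => (h0 d.1 d.2).trans (h0 d.1 _).symm) a b

/-- The diagram as a planar diagram. -/
def diagram : OrientedLinkDiagram where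
  toOrientedDiagramCode := code
  planar := by rw [card_face, card_piece]; rfl

theorem subsingleton_circle_stateA : Subsingleton (diagram.Circle diagram.stateA) := by
  refine ⟨fun a b => ?_⟩
  induction a using Quot.ind with
  | mk a =>
    induction b using Quot.ind with
    | mk b =>
      exact eq_of_invariant (diagram.circle diagram.stateA)
        (fun d => (OrientedLinkDiagram.circle_glue (D := diagram) diagram.stateA d).symm)
        (fun d => (OrientedLinkDiagram.circle_smooth diagram.stateA d.1 d.2).symm) a b

/-- The positions strictly between the first and the last end of the chord at `x`. -/
def side (x : Fin 11) (d : Fin 11 × Fin 4) : ZMod 2 :=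
  if (pos (x, 0) < pos d ∨ pos (x, 1) < pos d ∨ pos (x, 2) < pos d ∨ pos (x, 3) < pos d) ∧
    (pos d < pos (x, 0) ∨ pos d < pos (x, 1) ∨ pos d < pos (x, 2) ∨ pos d < pos (x, 3))
  then 1 else 0

theorem isSideSystem : diagram.IsSideSystem side where
  glue := by
    have : ∀ x d, side x (glue d) = side x d := by decide +kernel
    exact this
  smooth_of_ne := by
    have : ∀ (x y : Fin 11) k, y ≠ x →
        side x (y, OrientedLinkDiagram.smooth false k) = side x (y, k) := by decide +kernel
    exact this
  smooth_self := by
    have : ∀ (x : Fin 11) k, side x (x, OrientedLinkDiagram.smooth true k) = side x (x, k) := by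
      decide +kernel
    exact this
  jump := by
    have : ∀ x, side x (x, 0) + side x (x, 1) = 1 := by decide +kernel
    exact this

/-- The arc of the circle that begins at the end `k` of the chord at `x` stops at its end `l`. -/
def Follows (x : Fin 11) (k l : Fin 4) : Prop :=
  ∃ n : Fin 44, endAtNat ((pos (x, k)).val + n.val) = (x, l) ∧ ∀ m < n.val,
    ((pos (x, k)).val + m) % 2 = 0 → (endAtNat ((pos (x, k)).val + m)).1 ≠ x

instance (x : Fin 11) (k l : Fin 4) : Decidable (Follows x k l) :=
  inferInstanceAs (Decidable (∃ n : Fin 44, _ ∧ ∀ m < n.val, _ → _ ≠ x))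

theorem Follows.mk_eq {x : Fin 11} {k l : Fin 4} (h : Follows x k l) :
    (Quot.mk _ (x, k) : diagram.CutCircle x) = Quot.mk _ (x, l) := by
  obtain ⟨n, h1, h2⟩ := h
  let r : diagram.End → diagram.End → Prop :=
    fun d d' => d' = diagram.glue d ∨ (d.1 ≠ x ∧ d' = (d.1, OrientedLinkDiagram.smooth false d.2))
  have := eq_endAtNat_add (Quot.mk r) (pos (x, k)).val n.val fun m hm => Quot.sound
    ((endAtNat_succ _).imp id fun h => ⟨h2 m hm h.1, h.2⟩)
  rwa [h1, endAtNat_pos] at this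

/-- These are the two arcs cut off by the chord at `x`; which end comes first depends on the
crossing. -/
theorem follows : ∀ x, (Follows x 0 3 ∨ Follows x 3 0) ∧ (Follows x 1 2 ∨ Follows x 2 1) := by
  decide +kernel

/-- The chords at `x` and `y` alternate. -/
def Crosses (x y : Fin 11) : Prop :=
  (x, y) ∈ [(0, 1), (1, 2), (2, 3), (3, 4), (4, 5), (5, 0), (0, 6), (6, 7), (7, 8), (8, 9), (9, 10),
    (10, 0), (1, 0), (2, 1), (3, 2), (4, 3), (5, 4), (0, 5), (6, 0), (7, 6), (8, 7), (9, 8), (10, 9),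
    (0, 10)]

instance (x y : Fin 11) : Decidable (Crosses x y) := inferInstanceAs (Decidable (_ ∈ _))

theorem side_ne_iff : ∀ x y : Fin 11, x ≠ y → (side x (y, 0) ≠ side x (y, 2) ↔ Crosses x y) := by
  decide +kernel

theorem twoHexagons_adj (x y : Fin 11) : twoHexagons.Adj x y ↔ Crosses x y := by
  have : ∀ x y : Fin 11, Crosses x y ↔ s(x, y) ∈
      [s(0, 1), s(1, 2), s(2, 3), s(3, 4), s(4, 5), s(5, 0),
        s(0, 6), s(6, 7), s(7, 8), s(8, 9), s(9, 10), s(10, 0)] ∧ x ≠ y := by decide +kernel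
  rw [this, twoHexagons, SimpleGraph.fromEdgeSet_adj]
  simp only [List.mem_cons, List.not_mem_nil, or_false, Set.mem_insert_iff, Set.mem_singleton_iff]

theorem alternate_iff (x y : Fin 11) : diagram.Alternate x y ↔ side x (y, 0) ≠ side x (y, 2) :=
  isSideSystem.alternate_iff subsingleton_circle_stateA
    ((follows x).1.elim Follows.mk_eq fun h => h.mk_eq.symm)
    ((follows x).2.elim Follows.mk_eq fun h => h.mk_eq.symm) y

theorem nonempty_landoGraph_iso : Nonempty (diagram.landoGraph ≃g twoHexagons) := by
  have hadm : ∀ x, diagram.Admissible x := fun x =>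
    @Subsingleton.elim _ subsingleton_circle_stateA _ _
  have hsymm : ∀ x y, Crosses x y → Crosses y x := by decide +kernel
  refine ⟨⟨Equiv.subtypeUnivEquiv hadm, ?_⟩⟩
  rintro ⟨x, hx⟩ ⟨y, hy⟩
  refine (twoHexagons_adj x y).trans ?_
  rw [OrientedLinkDiagram.landoGraph, SimpleGraph.fromRel_adj]
  have hne : ∀ x y, Crosses x y → x ≠ y := by decide +kernel
  constructor
  · intro h
    exact ⟨fun e => hne x y h (congrArg Subtype.val e),
      Or.inl ((alternate_iff x y).2 ((side_ne_iff x y (hne x y h)).2 h))⟩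
  · rintro ⟨h, h' | h'⟩
    · exact (side_ne_iff x y fun e => h (Subtype.ext e)).1 ((alternate_iff x y).1 h')
    · exact hsymm _ _ ((side_ne_iff y x fun e => h (Subtype.ext e.symm)).1 ((alternate_iff y x).1 h'))

theorem numNeg_diagram : diagram.numNeg = 3 := by
  have : (Finset.univ.filter fun x => code.positive x = false).card = 3 := by decide +kernel
  exact this

theorem numPos_diagram : diagram.numPos = 8 := by
  have : (Finset.univ.filter fun x => code.positive x = true).card = 8 := by decide +kernel
  exact this

theorem extremeJ_diagram : diagram.extremeJ = 1 := by
  rw [OrientedLinkDiagram.extremeJ, OrientedLinkDiagram.writhe, numNeg_diagram, numPos_diagram]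
  norm_num

end TwoHexagonDiagram

namespace TwoHexagonDiagram

/-! ### The independence complex of two hexagons sharing a vertex -/

open OrientedLinkDiagram

/-- The sets of crossings whose chords do not alternate pairwise. -/
abbrev IndepSets : Set (Finset (Fin 11)) := noncrossingSets (D := diagram) side

theorem mem_indepSets {T : Finset (Fin 11)} :
    T ∈ IndepSets ↔ ∀ x ∈ T, ∀ y ∈ T, ¬Crosses x y := by
  have hne : ∀ x y, Crosses x y → x ≠ y := by decide +kernel
  constructor
  · exact fun h x hx y hy hc => (side_ne_iff x y (hne x y hc)).2 hc (h x hx y hy (hne x y hc))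
  · intro h x hx y hy hxy
    by_contra hs
    exact h x hx y hy ((side_ne_iff x y hxy).1 hs)

/-- The vertices `0, 2, 4, 7, 9` form a colour class of this bipartite graph, so each of the twelve
edges is listed once. -/
theorem mem_indepSets_iff {T : Finset (Fin 11)} :
    T ∈ IndepSets ↔ (0 ∈ T → 1 ∉ T ∧ 5 ∉ T ∧ 6 ∉ T ∧ 10 ∉ T) ∧ (2 ∈ T → 1 ∉ T ∧ 3 ∉ T) ∧
      (4 ∈ T → 3 ∉ T ∧ 5 ∉ T) ∧ (7 ∈ T → 6 ∉ T ∧ 8 ∉ T) ∧ (9 ∈ T → 8 ∉ T ∧ 10 ∉ T) := by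
  rw [mem_indepSets]
  constructor
  · intro h
    have h' : ∀ x y, Crosses x y → x ∈ T → y ∉ T := fun x y hc hx hy => h x hx y hy hc
    refine ⟨fun h0 => ⟨?_, ?_, ?_, ?_⟩, fun h0 => ⟨?_, ?_⟩, fun h0 => ⟨?_, ?_⟩, fun h0 => ⟨?_, ?_⟩,
      fun h0 => ⟨?_, ?_⟩⟩ <;> exact h' _ _ (by decide) h0
  · intro h x hx y hy hc
    simp only [Crosses, List.mem_cons, Prod.mk.injEq, List.not_mem_nil, or_false] at hc
    rcases hc with h | h | h | h | h | h | h | h | h | h | h | h | h | h | h | h | h | h | h | h |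
      h | h | h | h <;> obtain ⟨rfl, rfl⟩ := h <;> tauto

/-- The number of the block of a matching tree that contains `T`. -/
def block (T : Finset (Fin 11)) : ℕ :=
  if 0 ∈ T then if 3 ∉ T then 4 else if 8 ∉ T then 5 else 6
  else if 2 ∉ T then 0 else if 5 ∉ T then 1 else if 7 ∉ T then 2 else if 10 ∉ T then 3 else 6

/-- The vertex that is toggled in a block. -/
def apex : ℕ → Fin 11
  | 0 => 1
  | 1 => 4
  | 2 => 6
  | 3 => 9
  | 4 => 2
  | _ => 7

/-- Within one branch on `0`, adding vertices only moves a set further along the tests. If `0` is in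
`T` but not in `S`, then `5` is not in `S`, so `block S ≤ 1` while `block T ≥ 4`. -/
theorem block_mono {S T : Finset (Fin 11)} (h : S ⊆ T) (hT : T ∈ IndepSets) :
    block S ≤ block T := by
  have h0 := @h 0
  have h2 := @h 2
  have h3 := @h 3
  have h5 := @h 5
  have h7 := @h 7
  have h8 := @h 8
  have h10 := @h 10
  rw [mem_indepSets_iff] at hT
  clear h
  grind [block]

/-- In each block, both neighbours of the apex are absent, either by a test of the block or as
neighbours of a vertex known to be present. -/
theorem insert_apex_mem {m : ℕ} {T : Finset (Fin 11)} (hm : m < 6) (hT : T ∈ IndepSets)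
    (hb : block T = m) : insert (apex m) T ∈ IndepSets := by
  rw [mem_indepSets_iff] at hT ⊢
  interval_cases m <;> simp [apex, Finset.mem_insert] <;> grind [block]

/-- The apex is not among the vertices tested on the branch of its block. -/
theorem block_insert_apex {m : ℕ} {T : Finset (Fin 11)} (hm : m < 6)
    (hb : block T = m) : block (insert (apex m) T) = m := by
  rw [← hb]
  interval_cases m <;> simp [apex, block] <;> grind [block]

theorem block_erase_apex {m : ℕ} {T : Finset (Fin 11)} (hm : m < 6)
    (hb : block T = m) : block (T.erase (apex m)) = m := by
  rw [← hb]
  interval_cases m <;> simp [apex, block] <;> grind [block]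

/-- Reaching block 6 means containing one of the two critical sets. Each of them dominates the
graph, so no independent set is strictly larger. -/
theorem eq_of_six_le_block {S T : Finset (Fin 11)} (hST : S ⊆ T) (hT : T ∈ IndepSets)
    (hS : 6 ≤ block S) : S = T ∧ (T = {0, 3, 8} ∨ T = {2, 5, 7, 10}) := by
  rw [mem_indepSets_iff] at hT
  have h : (0 ∈ S ∧ 3 ∈ S ∧ 8 ∈ S) ∨ (2 ∈ S ∧ 5 ∈ S ∧ 7 ∈ S ∧ 10 ∈ S) := by grind [block]
  have key : ∀ {U : Finset (Fin 11)}, U ⊆ T → (∀ x ∈ U, x ∈ S) → (∀ x ∈ T, x ∈ U) →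
      S = T ∧ T = U := fun hU hUS hTU =>
    ⟨hST.antisymm fun x hx => hUS x (hTU x hx), Finset.Subset.antisymm hTU hU⟩
  rcases h with ⟨h1, h2, h3⟩ | ⟨h1, h2, h3, h4⟩
  · have t1 := hST h1
    have t2 := hST h2
    have t3 := hST h3
    refine (key (U := {0, 3, 8}) ?_ ?_ ?_).imp id Or.inl
    · simp [Finset.insert_subset_iff, t1, t2, t3]
    · simp [h1, h2, h3]
    · intro x hx
      fin_cases x <;> simp <;> simp at hx <;> tauto
  · have t1 := hST h1
    have t2 := hST h2
    have t3 := hST h3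
    have t4 := hST h4
    refine (key (U := {2, 5, 7, 10}) ?_ ?_ ?_).imp id Or.inr
    · simp [Finset.insert_subset_iff, t1, t2, t3, t4]
    · simp [h1, h2, h3, h4]
    · intro x hx
      fin_cases x <;> simp <;> simp at hx <;> tauto

theorem isToggling : FinsetCochain.IsToggling IndepSets block apex 6 where
  down h hT := fun x hx y hy => hT x (h hx) y (h hy)
  mono := block_mono
  insert_mem := insert_apex_mem
  block_insert hm _ := block_insert_apex hm
  block_erase hm _ := block_erase_apex hm

end TwoHexagonDiagram

/-! ### The extreme cohomology of the two-hexagon diagram. -/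

open TwoHexagonDiagram in
theorem theorem5p4 :
    ∃ D : OrientedLinkDiagram,
      D.crossings = 11 ∧ D.numNeg = 3 ∧
      Nat.card (D.Circle D.stateA) = 1 ∧
      Nonempty (D.landoGraph ≃g twoHexagons) ∧
      IsLeast (Set.range D.degJ) 1 ∧
      ∀ (R : Type*) [CommRing R],
        Nonempty (D.Khovanov R 0 1 ≃ₗ[R] R) ∧
        Nonempty (D.Khovanov R 1 1 ≃ₗ[R] R) ∧
        ∀ i : ℤ, i ≠ 0 → i ≠ 1 → Subsingleton (D.Khovanov R i 1) := by
  have hA := subsingleton_circle_stateA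
  have d₀ : diagram.End := endAt 0
  have hN : (diagram.numNeg : ℤ) = 3 := by rw [numNeg_diagram]; rfl
  have hcrit : ∀ T ∈ IndepSets, 6 ≤ block T → T = {0, 3, 8} ∨ T = {2, 5, 7, 10} :=
    fun T hT hb => (eq_of_six_le_block subset_rfl hT hb).2
  have hmax : ∀ S T, S ⊆ T → T ∈ IndepSets → 6 ≤ block S → S = T :=
    fun S T h hT hb => (eq_of_six_le_block h hT hb).1
  have c3 : ((({0, 3, 8} : Finset (Fin 11)).card : ℕ) : ℤ) = 3 := by rfl
  have c4 : ((({2, 5, 7, 10} : Finset (Fin 11)).card : ℕ) : ℤ) = 4 := by rfl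
  have m3 : ({0, 3, 8} : Finset (Fin 11)) ∈ IndepSets := mem_indepSets.2 (by decide)
  have m4 : ({2, 5, 7, 10} : Finset (Fin 11)) ∈ IndepSets := mem_indepSets.2 (by decide)
  refine ⟨diagram, rfl, numNeg_diagram,
    Nat.card_eq_one_iff_unique.2 ⟨hA, ⟨diagram.circle _ d₀⟩⟩, nonempty_landoGraph_iso, ?_, ?_⟩
  · rw [← extremeJ_diagram]
    refine ⟨?_, ?_⟩
    -- The critical set `{0, 3, 8}` yields an enhanced state attaining the minimum.
    · obtain ⟨g, -⟩ := isSideSystem.exists_generator (i := 0) hA d₀ m3 (c3.trans (by rw [hN]; rfl))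
      exact ⟨g.1, g.2.2⟩
    · rintro _ ⟨S, rfl⟩
      exact OrientedLinkDiagram.extremeJ_le_degJ hA d₀ S
  · intro R _
    -- A variable `j` lets `extremeJ` be substituted without rewriting inside the dependent
    -- cohomology modules.
    suffices ∀ j, diagram.extremeJ = j → Nonempty (diagram.Khovanov R 0 j ≃ₗ[R] R) ∧
        Nonempty (diagram.Khovanov R 1 j ≃ₗ[R] R) ∧
        ∀ i : ℤ, i ≠ 0 → i ≠ 1 → Subsingleton (diagram.Khovanov R i j) from
      this 1 extremeJ_diagram
    rintro _ rfl
    refine ⟨?_, ?_, fun i h0 h1 => ?_⟩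
    · refine isSideSystem.nonempty_khovanov_equiv hA d₀ isToggling m3 (c3.trans (by rw [hN]; rfl))
        (by decide) (fun T hT hc hb => ?_) hmax
      rcases hcrit T hT hb with rfl | rfl
      · rfl
      · rw [hN] at hc
        exact absurd (c4.symm.trans hc) (by decide)
    · refine isSideSystem.nonempty_khovanov_equiv hA d₀ isToggling m4 (c4.trans (by rw [hN]; rfl))
        (by decide) (fun T hT hc hb => ?_) hmax
      rcases hcrit T hT hb with rfl | rfl
      · rw [hN] at hc
        exact absurd (c3.symm.trans hc) (by decide)
      · rfl
    · refine isSideSystem.subsingleton_khovanov hA d₀ isToggling fun T hT hc => ?_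
      by_contra hb
      rcases hcrit T hT (not_lt.1 hb) with rfl | rfl
      · rw [hN] at hc
        have := c3.symm.trans hc
        omega
      · rw [hN] at hc
        have := c4.symm.trans hc
        omega
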